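/- **Theorem.** Let $k$ be a field and let $A$ be a finite-dimensional (associative, unital) $k$-algebra. Let $A\text{-mod}$ be the abelian category of finite-dimensional left $A$-modules, and let $D^b(A\text{-mod})$ be its bounded derived category. Then $D^b(A\text{-mod})$ is a Krull–Schmidt category: every object $X$ of $D^b(A\text{-mod})$ has a finite direct sum decomposition $X\cong X_1\oplus\cdots\oplus X_n$ (with $n\ge 0$; $n=0$ for $X=0$) in which each $X_i$ is indecomposable and has a local endomorphism ring. -/

import Mathlib

open CategoryTheory CategoryTheory.Limits

/-- An additive category is Krull-Schmidt if every object is isomorphic to a finite direct sum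
(possibly empty, for the zero object) of indecomposable objects with local endomorphism rings. -/
class IsKrullSchmidt (C : Type*) [Category C] [Preadditive C] [HasFiniteBiproducts C] : Prop where
  exists_decomposition : ∀ X : C, ∃ (n : ℕ) (Y : Fin n → C),
    haveI := hasBinaryBiproducts_of_finite_biproducts C
    Nonempty (X ≅ ⨁ Y) ∧ ∀ i, Indecomposable (Y i) ∧ IsLocalRing (End (Y i))

/-- For a finite-dimensional `k`-algebra `A`, finitely generated `A`-modules are the same as
finite-dimensional ones, so `FGModuleCat A` is the category of finite-dimensional modules. -/
theorem finite_iff_finiteDimensional (k A M : Type*) [Field k] [Ring A] [Algebra k A]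
    [FiniteDimensional k A] [AddCommGroup M] [Module k M] [Module A M] [IsScalarTower k A M] :
    Module.Finite A M ↔ FiniteDimensional k M :=
  ⟨fun _ => Module.Finite.trans A M, fun _ => Module.Finite.of_restrictScalars_finite k A M⟩

universe u v w

/-
A bounded object `X` of the derived category is represented by a bounded above complex `P` of
projectives, hence also by the bounded complex `K = τ≥a P`. Every endomorphism of `X` is induced by
one of `P`, because `P` is K-projective, and so by one of `K`, because truncation is functorial:
`End K → End X` is surjective. As `End K` has finite length and idempotents split in the category of
complexes, `K` is a finite direct sum of indecomposables, whose endomorphism rings are local by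
Fitting's lemma. Localization sends each summand to an object whose endomorphism ring is a quotient
of a local ring, that is zero or local; its nonzero images are the required summands of `X`, and
they are bounded because they are retracts of `X`.
-/

section Ring

theorem isUnit_or_isNilpotent_moduleEnd {R M : Type*} [Ring R] [AddCommGroup M] [Module R M]
    [IsNoetherian R M] [IsArtinian R M]
    (h : ∀ e : Module.End R M, IsIdempotentElem e → e = 0 ∨ e = 1) (f : Module.End R M) :
    IsUnit f ∨ IsNilpotent f := by
  obtain ⟨n, hn, hn0⟩ :=
    (f.eventually_isCompl_ker_pow_range_pow.and (Filter.eventually_ne_atTop 0)).exists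
  have range_projection := Submodule.range_projection hn
  rcases h _ (Submodule.isIdempotentElem_projection hn) with h0 | h1
  · left
    have ker_eq_bot : (f ^ n).ker = ⊥ := by rw [← range_projection, h0, LinearMap.range_zero]
    have range_eq_top : (f ^ n).range = ⊤ := by simpa [ker_eq_bot] using hn.sup_eq_top
    rw [← isUnit_pow_iff hn0, Module.End.isUnit_iff]
    exact ⟨LinearMap.ker_eq_bot.1 ker_eq_bot, LinearMap.range_eq_top.1 range_eq_top⟩
  · right
    exact ⟨n, by
      rw [← LinearMap.ker_eq_top, ← range_projection, h1, Module.End.one_eq_id, LinearMap.range_id]⟩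

theorem isUnit_or_isNilpotent_of_isArtinianRing {R : Type*} [Ring R] [IsArtinianRing R]
    (h : ∀ e : R, IsIdempotentElem e → e = 0 ∨ e = 1) (r : R) : IsUnit r ∨ IsNilpotent r := by
  let φ : Rᵐᵒᵖ ≃+* Module.End R R := RingEquiv.moduleEndSelf R
  have idempotents (e : Module.End R R) (he : IsIdempotentElem e) : e = 0 ∨ e = 1 := by
    simpa using h (φ.symm e).unop (congrArg MulOpposite.unop (he.map φ.symm))
  have unit_or_nilpotent := isUnit_or_isNilpotent_moduleEnd idempotents (φ (.op r))
  rw [MulEquiv.isUnit_map, IsNilpotent.map_iff φ.injective, isUnit_op] at unit_or_nilpotent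
  exact unit_or_nilpotent.imp_right fun ⟨n, hn⟩ ↦ ⟨n, MulOpposite.op_injective hn⟩

theorem isLocalRing_of_isArtinianRing {R : Type*} [Ring R] [IsArtinianRing R] [Nontrivial R]
    (h : ∀ e : R, IsIdempotentElem e → e = 0 ∨ e = 1) : IsLocalRing R where
  isUnit_or_isUnit_of_add_one {a b} hab := by
    obtain rfl : b = 1 - a := eq_sub_of_add_eq' hab
    exact (isUnit_or_isNilpotent_of_isArtinianRing h a).imp_right IsNilpotent.isUnit_one_sub

theorem isLocalRing_of_surjective {R S : Type*} [Ring R] [IsLocalRing R] [Ring S]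
    [Nontrivial S] (f : R →+* S) (hf : Function.Surjective f) : IsLocalRing S where
  isUnit_or_isUnit_of_add_one {a b} hab := by
    obtain ⟨a, rfl⟩ := hf a
    obtain rfl : b = f (1 - a) := by rw [map_sub, map_one, ← hab, add_sub_cancel_left]
    exact (IsLocalRing.isUnit_or_isUnit_of_add_one (add_sub_cancel a 1)).imp
      (·.map f) (·.map f)

theorem eq_zero_or_eq_one_of_isIdempotentElem {R : Type*} [Ring R] [IsLocalRing R]
    {e : R} (he : IsIdempotentElem e) : e = 0 ∨ e = 1 := by
  rcases IsLocalRing.isUnit_or_isUnit_of_add_one (add_sub_cancel e 1) with h | h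
  · exact .inr ((IsIdempotentElem.iff_eq_one_of_isUnit h).1 he)
  · exact .inl (h.mul_left_cancel (he.one_sub_mul_self.trans (mul_zero _).symm))

end Ring

section Indecomposable

variable {C : Type*} [Category C] [Preadditive C]

theorem isZero_iff_retract_comp_eq_zero {X Y : C} (r : Retract Y X) :
    IsZero Y ↔ r.r ≫ r.i = 0 := by
  rw [IsZero.iff_id_eq_zero]
  refine ⟨fun h ↦ ?_, fun h ↦ ?_⟩
  · rw [← Category.id_comp r.i, h, zero_comp, comp_zero]
  · calc 𝟙 Y = r.i ≫ (r.r ≫ r.i) ≫ r.r := by simp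
      _ = 0 := by rw [h, zero_comp, comp_zero]

variable [HasBinaryBiproducts C]

/-- The left summand of a decomposition `X ≅ Y ⊞ Z`, as a retract of `X`. -/
@[simps]
noncomputable def leftRetract {X Y Z : C} (e : X ≅ Y ⊞ Z) : Retract Y X where
  i := biprod.inl ≫ e.inv
  r := e.hom ≫ biprod.fst

/-- The right summand of a decomposition `X ≅ Y ⊞ Z`, as a retract of `X`. -/
@[simps]
noncomputable def rightRetract {X Y Z : C} (e : X ≅ Y ⊞ Z) : Retract Z X where
  i := biprod.inr ≫ e.inv
  r := e.hom ≫ biprod.snd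

theorem leftRetract_comp_add_rightRetract_comp {X Y Z : C} (e : X ≅ Y ⊞ Z) :
    (leftRetract e).r ≫ (leftRetract e).i + (rightRetract e).r ≫ (rightRetract e).i = 𝟙 X :=
  calc
    _ = e.hom ≫ (biprod.fst ≫ biprod.inl + biprod.snd ≫ biprod.inr) ≫ e.inv := by
      simp only [leftRetract_i, leftRetract_r, rightRetract_i, rightRetract_r,
        Preadditive.add_comp, Preadditive.comp_add, Category.assoc]
    _ = 𝟙 X := by rw [biprod.total, Category.id_comp, e.hom_inv_id]

theorem isZero_left_iff_rightRetract_comp_eq_id {X Y Z : C} (e : X ≅ Y ⊞ Z) :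
    IsZero Y ↔ (rightRetract e).r ≫ (rightRetract e).i = 𝟙 X := by
  rw [isZero_iff_retract_comp_eq_zero (leftRetract e), ← leftRetract_comp_add_rightRetract_comp e,
    right_eq_add]

theorem isZero_right_iff_leftRetract_comp_eq_id {X Y Z : C} (e : X ≅ Y ⊞ Z) :
    IsZero Z ↔ (leftRetract e).r ≫ (leftRetract e).i = 𝟙 X := by
  rw [isZero_iff_retract_comp_eq_zero (rightRetract e), ← leftRetract_comp_add_rightRetract_comp e,
    left_eq_add]

theorem exists_iso_biprod_of_idempotent [IsIdempotentComplete C] {X : C} (p : X ⟶ X)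
    (hp : p ≫ p = p) :
    ∃ (Y Z : C) (e : X ≅ Y ⊞ Z), (leftRetract e).r ≫ (leftRetract e).i = p := by
  obtain ⟨Y, i, r, hir, hri⟩ := IsIdempotentComplete.idempotents_split X p hp
  obtain ⟨Z, j, s, hjs, hsj⟩ := IsIdempotentComplete.idempotents_split X (𝟙 X - p) (by simp [hp])
  have : IsSplitMono i := ⟨⟨r, hir⟩⟩
  have : IsSplitEpi r := ⟨⟨i, hir⟩⟩
  have : IsSplitMono j := ⟨⟨s, hjs⟩⟩
  have : IsSplitEpi s := ⟨⟨j, hjs⟩⟩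
  let b : BinaryBicone Y Z :=
    { pt := X, fst := r, snd := s, inl := i, inr := j
      inl_fst := hir
      inl_snd := by
        rw [← cancel_epi r, ← cancel_mono j]
        simp [hsj, reassoc_of% hri, hp]
      inr_fst := by
        rw [← cancel_epi s, ← cancel_mono i]
        simp [hri, reassoc_of% hsj, hp]
      inr_snd := hjs }
  have hb : b.IsBilimit := isBinaryBilimitOfTotal b (by simp [b, hri, hsj])
  exact ⟨Y, Z, biprod.uniqueUpToIso Y Z hb, by simp [b, hri]⟩

theorem indecomposable_of_isLocalRing_end (X : C) [IsLocalRing (End X)] : Indecomposable X := by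
  refine ⟨fun h ↦ one_ne_zero (α := End X) (h.eq_of_src _ _), fun Y Z e ↦ ?_⟩
  let p : End X := (leftRetract e).r ≫ (leftRetract e).i
  have hp : IsIdempotentElem p := by simp [p, IsIdempotentElem, End.mul_def]
  exact (eq_zero_or_eq_one_of_isIdempotentElem hp).imp (isZero_iff_retract_comp_eq_zero _).2
    (isZero_right_iff_leftRetract_comp_eq_id e).2

theorem isLocalRing_end_of_indecomposable [IsIdempotentComplete C] {X : C}
    [IsArtinianRing (End X)] (hX : Indecomposable X) : IsLocalRing (End X) := by
  have : Nontrivial (End X) := ⟨𝟙 X, 0, fun h ↦ hX.1 ((IsZero.iff_id_eq_zero X).2 h)⟩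
  refine isLocalRing_of_isArtinianRing fun p hp ↦ ?_
  obtain ⟨Y, Z, e, he⟩ := exists_iso_biprod_of_idempotent p hp
  rw [← he]
  exact (hX.2 Y Z e).imp (isZero_iff_retract_comp_eq_zero _).1
    (isZero_right_iff_leftRetract_comp_eq_id e).1

end Indecomposable

section FiniteLength

variable (k : Type*) [CommRing k] {C : Type*} [Category C] [Preadditive C] [Linear k C] {X Y : C}

/-- For a retract `Y` of `X`, the embedding `f ↦ r ≫ f ≫ i` of the endomorphisms of `Y` into
those of `X`, as a (nonunital) map of `k`-modules. -/
@[simps!]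
def retractEndMap (r : Retract Y X) : (Y ⟶ Y) →ₗ[k] (X ⟶ X) :=
  (Linear.leftComp k X r.r).comp (Linear.rightComp k Y r.i)

theorem retractEndMap_injective (r : Retract Y X) : Function.Injective (retractEndMap k r) :=
  Function.LeftInverse.injective (g := fun f ↦ r.i ≫ f ≫ r.r) fun f ↦ by simp

theorem length_end_lt_of_retract (r : Retract Y X) (hX : IsFiniteLength k (X ⟶ X))
    (hr : r.r ≫ r.i ≠ 𝟙 X) : Module.length k (Y ⟶ Y) < Module.length k (X ⟶ X) := by
  obtain ⟨_, _⟩ := isFiniteLength_iff_isNoetherian_isArtinian.1 hX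
  rw [(LinearEquiv.ofInjective _ (retractEndMap_injective k r)).length_eq]
  refine Submodule.length_lt fun range_eq_top ↦ hr ?_
  obtain ⟨f, hf⟩ := LinearMap.range_eq_top.1 range_eq_top (𝟙 X)
  rw [retractEndMap_apply] at hf
  calc r.r ≫ r.i = (r.r ≫ r.i) ≫ r.r ≫ f ≫ r.i := by rw [hf, Category.comp_id]
    _ = r.r ≫ f ≫ r.i := by simp
    _ = 𝟙 X := hf

variable {k}

theorem isArtinianRing_end (hX : IsFiniteLength k (X ⟶ X)) : IsArtinianRing (End X) :=
  have : IsArtinian k (End X) := (isFiniteLength_iff_isNoetherian_isArtinian.1 hX).2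
  isArtinian_of_tower k this

end FiniteLength

/-- `X` is zero or can be split repeatedly into binary direct sums until every nonzero summand has
a local endomorphism ring. -/
inductive HasLocalDecomposition {C : Type*} [Category C] [Preadditive C] [HasBinaryBiproducts C] :
    C → Prop
  | of_isZero {X : C} (hX : IsZero X) : HasLocalDecomposition X
  | of_isLocalRing_end {X : C} (hX : IsLocalRing (End X)) : HasLocalDecomposition X
  | of_iso_biprod {X Y Z : C} (e : X ≅ Y ⊞ Z) (hY : HasLocalDecomposition Y)
      (hZ : HasLocalDecomposition Z) : HasLocalDecomposition X

theorem hasLocalDecomposition_of_isFiniteLength {C : Type*} [Category C] [Preadditive C]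
    [HasBinaryBiproducts C] [IsIdempotentComplete C] (k : Type*) [CommRing k] [Linear k C] (X : C)
    (hX : IsFiniteLength k (X ⟶ X)) : HasLocalDecomposition X := by
  induction hn : Module.length k (X ⟶ X) using WellFoundedLT.induction generalizing X with
  | _ n ih =>
  subst hn
  have decomposition_of_retract {Y : C} (r : Retract Y X) (hr : r.r ≫ r.i ≠ 𝟙 X) :
      HasLocalDecomposition Y :=
    ih _ (length_end_lt_of_retract k r hX hr) Y (hX.of_injective (retractEndMap_injective k r)) rfl
  by_cases hzero : IsZero X
  · exact .of_isZero hzero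
  by_cases hind : Indecomposable X
  · have := isArtinianRing_end hX
    exact .of_isLocalRing_end (isLocalRing_end_of_indecomposable hind)
  · simp only [Indecomposable, hzero, not_false_eq_true, true_and, not_forall, not_or] at hind
    obtain ⟨Y, Z, e, hY, hZ⟩ := hind
    exact .of_iso_biprod e
      (decomposition_of_retract _ ((isZero_right_iff_leftRetract_comp_eq_id e).not.1 hZ))
      (decomposition_of_retract _ ((isZero_left_iff_rightRetract_comp_eq_id e).not.1 hY))

theorem map_surjective_of_retract {C D : Type*} [Category C] [Category D]
    (F : C ⥤ D) {X Y : C} (r : Retract Y X)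
    (hF : Function.Surjective (F.map : (X ⟶ X) → (F.obj X ⟶ F.obj X))) :
    Function.Surjective (F.map : (Y ⟶ Y) → (F.obj Y ⟶ F.obj Y)) := fun g ↦ by
  obtain ⟨f, hf⟩ := hF (F.map r.r ≫ g ≫ F.map r.i)
  have hr : F.map r.i ≫ F.map r.r = 𝟙 _ := (r.map F).retract
  exact ⟨r.i ≫ f ≫ r.r, by simp [hf, reassoc_of% hr, hr]⟩

section Functor

variable {C D : Type*} [Category C] [Category D] [Preadditive C] [Preadditive D]

/-- The action of an additive functor on the endomorphism ring of an object. -/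
def mapEndRingHom (F : C ⥤ D) [F.Additive] (X : C) : End X →+* End (F.obj X) :=
  { F.mapEnd X with
    map_zero' := F.map_zero X X
    map_add' := fun _ _ ↦ F.map_add }

theorem isLocalRing_end_of_fullyFaithful (F : C ⥤ D) [F.Additive] [F.Full] [F.Faithful] {X : C}
    (_ : IsLocalRing (End (F.obj X))) : IsLocalRing (End X) :=
  have : Nontrivial (End X) := (mapEndRingHom F X).domain_nontrivial
  let φ : End X ≃+* End (F.obj X) :=
    .ofBijective (mapEndRingHom F X) ⟨F.map_injective, F.map_surjective⟩
  isLocalRing_of_surjective φ.symm.toRingHom φ.symm.surjective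

end Functor

/-- The direct sum of two biproducts, as the biproduct of the disjoint union of the families. -/
noncomputable def biprodBiproductIso {C : Type*} [Category C] [HasZeroMorphisms C]
    [HasBinaryBiproducts C] [HasFiniteBiproducts C] {ι κ : Type*} [Finite ι] [Finite κ]
    (f : ι → C) (g : κ → C) : (⨁ f) ⊞ (⨁ g) ≅ ⨁ Sum.elim f g :=
  (Fan.combPairIsLimit (biproduct.isLimit f) (biproduct.isLimit g)
    (BinaryBiproduct.isLimit _ _)).conePointUniqueUpToIso (biproduct.isLimit _)

namespace HasLocalDecomposition

section Functoriality

variable {C D : Type*} [Category C] [Category D] [Preadditive C] [Preadditive D]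
variable [HasBinaryBiproducts C] [HasBinaryBiproducts D]

theorem of_iso [HasZeroObject C] {X Y : C} (hX : HasLocalDecomposition X) (e : Y ≅ X) :
    HasLocalDecomposition Y :=
  .of_iso_biprod (e ≪≫ isoBiprodZero (isZero_zero C)) hX (.of_isZero (isZero_zero C))

theorem map {X : C} (hX : HasLocalDecomposition X) (F : C ⥤ D) [F.Additive]
    (hF : Function.Surjective (F.map : (X ⟶ X) → (F.obj X ⟶ F.obj X))) :
    HasLocalDecomposition (F.obj X) := by
  induction hX with
  | of_isZero hX => exact .of_isZero (F.map_isZero hX)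
  | @of_isLocalRing_end X hX =>
    by_cases hzero : IsZero (F.obj X)
    · exact .of_isZero hzero
    · have : Nontrivial (End (F.obj X)) :=
        ⟨𝟙 _, 0, fun h ↦ hzero ((IsZero.iff_id_eq_zero _).2 h)⟩
      exact .of_isLocalRing_end (isLocalRing_of_surjective (mapEndRingHom F X) hF)
  | of_iso_biprod e _ _ ihY ihZ =>
    have := preservesBinaryBiproducts_of_preservesBiproducts F
    exact .of_iso_biprod (F.mapIso e ≪≫ F.mapBiprod _ _)
      (ihY (map_surjective_of_retract F (leftRetract e) hF))
      (ihZ (map_surjective_of_retract F (rightRetract e) hF))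

theorem fullSubcategory (P : ObjectProperty C) [P.IsStableUnderRetracts]
    [HasBinaryBiproducts P.FullSubcategory] {X : C} (hX : HasLocalDecomposition X) (hPX : P X) :
    HasLocalDecomposition (⟨X, hPX⟩ : P.FullSubcategory) := by
  induction hX with
  | of_isZero hX => exact .of_isZero (.of_full_of_faithful_of_isZero P.ι _ hX)
  | of_isLocalRing_end hX => exact .of_isLocalRing_end (isLocalRing_end_of_fullyFaithful P.ι hX)
  | @of_iso_biprod X Y Z e _ _ ihY ihZ =>
    have hPY : P Y := P.prop_of_retract (leftRetract e) hPX
    have hPZ : P Z := P.prop_of_retract (rightRetract e) hPX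
    have := preservesBinaryBiproducts_of_preservesBiproducts P.ι
    exact .of_iso_biprod
      (P.ι.preimageIso (e ≪≫ (P.ι.mapBiprod ⟨Y, hPY⟩ ⟨Z, hPZ⟩).symm)) (ihY hPY) (ihZ hPZ)

end Functoriality

theorem exists_iso_biproduct {C : Type*} [Category C] [Preadditive C] [HasBinaryBiproducts C]
    [HasFiniteBiproducts C] {X : C} (hX : HasLocalDecomposition X) :
    ∃ (n : ℕ) (Y : Fin n → C), Nonempty (X ≅ ⨁ Y) ∧ ∀ i, IsLocalRing (End (Y i)) := by
  induction hX with
  | of_isZero hX =>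
    have : IsZero (⨁ (Fin.elim0 : Fin 0 → C)) :=
      (IsZero.iff_id_eq_zero _).2 (biproduct.hom_ext _ _ fun i ↦ i.elim0)
    exact ⟨0, Fin.elim0, ⟨hX.iso this⟩, fun i ↦ i.elim0⟩
  | @of_isLocalRing_end X hX =>
    exact ⟨1, fun _ ↦ X, ⟨(biproductUniqueIso fun _ : Fin 1 ↦ X).symm⟩, fun _ ↦ hX⟩
  | of_iso_biprod e _ _ ihY ihZ =>
    obtain ⟨m, f, ⟨ef⟩, hf⟩ := ihY
    obtain ⟨n, g, ⟨eg⟩, hg⟩ := ihZ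
    have hfg (j : Fin m ⊕ Fin n) : IsLocalRing (End (Sum.elim f g j)) := Sum.rec hf hg j
    exact ⟨m + n, Sum.elim f g ∘ finSumFinEquiv.symm,
      ⟨e ≪≫ biprod.mapIso ef eg ≪≫ biprodBiproductIso f g ≪≫
        (biproduct.reindex finSumFinEquiv.symm _).symm⟩,
      fun _ ↦ hfg _⟩

end HasLocalDecomposition

section TStructure

open Triangulated

variable {D : Type*} [Category D] [Preadditive D] [HasZeroObject D] [HasShift D ℤ]
  [∀ n : ℤ, (shiftFunctor D n).Additive] [Pretriangulated D] (t : TStructure D)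

theorem isGE_of_retract {X Y : D} (r : Retract Y X) (n : ℤ) [t.IsGE X n] : t.IsGE Y n :=
  (t.isGE_iff_isZero_truncLT_obj n Y).2
    (IsZero.of_mono (r.map (t.truncLT n)).i (t.isZero_truncLT_obj_of_isGE n X))

theorem isLE_of_retract {X Y : D} (r : Retract Y X) (n : ℤ) [t.IsLE X n] : t.IsLE Y n :=
  (t.isLE_iff_isZero_truncGE_obj n _ rfl Y).2
    (IsZero.of_mono (r.map (t.truncGE (n + 1))).i (t.isZero_truncGE_obj_of_isLE n _ rfl X))

instance isStableUnderRetracts_bounded : t.bounded.IsStableUnderRetracts where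
  of_retract r := fun ⟨⟨a, _⟩, ⟨b, _⟩⟩ ↦ ⟨⟨a, isGE_of_retract t r a⟩, ⟨b, isLE_of_retract t r b⟩⟩

end TStructure

section CochainComplex

variable {C : Type*} [Category C] [Preadditive C]

theorem isFiniteLength_hom_of_isStrictlyGE_of_isStrictlyLE (k : Type*) [CommRing k] [Linear k C]
    (K L : CochainComplex C ℤ) (a b : ℤ) [K.IsStrictlyGE a] [K.IsStrictlyLE b]
    (h : ∀ i, IsFiniteLength k (K.X i ⟶ L.X i)) : IsFiniteLength k (K ⟶ L) := by
  let φ : (K ⟶ L) →ₗ[k] (∀ i : Set.Icc a b, K.X i ⟶ L.X i) :=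
    { toFun := fun f i ↦ f.f i
      map_add' := fun _ _ ↦ rfl
      map_smul' := fun _ _ ↦ rfl }
  have hφ : Function.Injective φ := fun f g hfg ↦ by
    ext i
    by_cases hi : i ∈ Set.Icc a b
    · exact congrFun hfg ⟨i, hi⟩
    rcases not_and_or.1 hi with hi | hi
    · exact (K.isZero_of_isStrictlyGE a i (by lia)).eq_of_src _ _
    · exact (K.isZero_of_isStrictlyLE b i (by lia)).eq_of_src _ _
  simp only [isFiniteLength_iff_isNoetherian_isArtinian, forall_and] at h
  obtain ⟨_, _⟩ := h
  exact IsFiniteLength.of_injective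
    (isFiniteLength_iff_isNoetherian_isArtinian.2 ⟨inferInstance, inferInstance⟩) hφ

variable [HasBinaryBiproducts C]

theorem isStrictlyLE_mappingCone {K L : CochainComplex C ℤ} (f : K ⟶ L) (m n : ℤ)
    [K.IsStrictlyLE m] [L.IsStrictlyLE n] :
    (CochainComplex.mappingCone f).IsStrictlyLE (max (m - 1) n) := by
  rw [CochainComplex.isStrictlyLE_iff]
  intro i hi
  rw [CochainComplex.mappingCone.isZero_X_iff]
  exact ⟨K.isZero_of_isStrictlyLE m _ (by lia), L.isZero_of_isStrictlyLE n _ (by lia)⟩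

theorem projective_mappingCone_X {K L : CochainComplex C ℤ} (f : K ⟶ L)
    [∀ i, Projective (K.X i)] [∀ i, Projective (L.X i)] (i : ℤ) :
    Projective ((CochainComplex.mappingCone f).X i) :=
  .of_iso (HomologicalComplex.homotopyCofiber.XIsoBiprod f i (i + 1) rfl).symm inferInstance

end CochainComplex

section Derived

open DerivedCategory Pretriangulated Triangulated TStructure

variable {C : Type u} [Category.{v} C] [Abelian C] [HasDerivedCategory.{w} C]

theorem Q_map_surjective_of_isKProjective (K L : CochainComplex C ℤ) [K.IsKProjective] :
    Function.Surjective (Q.map : (K ⟶ L) → (Q.obj K ⟶ Q.obj L)) := fun f ↦ by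
  obtain ⟨g, hg⟩ := (CochainComplex.IsKProjective.Qh_map_bijective K
    ((HomotopyCategory.quotient _ _).obj L)).surjective
      ((quotientCompQhIso C).hom.app K ≫ f ≫ (quotientCompQhIso C).inv.app L)
  obtain ⟨g, rfl⟩ := (HomotopyCategory.quotient C (.up ℤ)).map_surjective g
  refine ⟨g, ?_⟩
  rw [← cancel_epi ((quotientCompQhIso C).hom.app K), ← quotientCompQhIso_hom_naturality, hg]
  simp

/-- Truncation is functorial and `K ⟶ τ≥a K` becomes invertible, so surjectivity is inherited. -/
theorem Q_map_truncGE_surjective (K : CochainComplex C ℤ) (a : ℤ) [K.IsGE a]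
    (hK : Function.Surjective (Q.map : (K ⟶ K) → (Q.obj K ⟶ Q.obj K))) :
    Function.Surjective (Q.map : (K.truncGE a ⟶ K.truncGE a) → _) := fun g ↦ by
  obtain ⟨f, hf⟩ := hK (Q.map (K.πTruncGE a) ≫ g ≫ inv (Q.map (K.πTruncGE a)))
  refine ⟨CochainComplex.truncGEMap f a, ?_⟩
  rw [← cancel_epi (Q.map (K.πTruncGE a)), ← Q.map_comp, CochainComplex.πTruncGE_naturality,
    Q.map_comp, hf]
  simp

/-- The objects of the derived category represented by a bounded above complex of projectives. -/
def hasProjectiveModel : ObjectProperty (DerivedCategory C) := fun X ↦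
  ∃ (P : CochainComplex C ℤ) (n : ℤ), P.IsStrictlyLE n ∧ (∀ i, Projective (P.X i)) ∧
    Nonempty (Q.obj P ≅ X)

instance : (hasProjectiveModel (C := C)).IsClosedUnderIsomorphisms where
  of_iso e := fun ⟨P, n, hn, hP, ⟨e'⟩⟩ ↦ ⟨P, n, hn, hP, ⟨e' ≪≫ e⟩⟩

instance : (hasProjectiveModel (C := C)).IsStableUnderShift ℤ where
  isStableUnderShiftBy a :=
    ⟨fun _ ⟨P, n, hn, hP, ⟨e⟩⟩ ↦ ⟨P⟦a⟧, n - a, P.isStrictlyLE_shift n a (n - a) (by lia),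
      fun _ ↦ hP _, ⟨(Q.commShiftIso a).app P ≪≫ (shiftFunctor _ a).mapIso e⟩⟩⟩

instance : (hasProjectiveModel (C := C)).IsTriangulatedClosed₃ := .mk'
  fun T hT ⟨P, m, _, _, ⟨e₁⟩⟩ ⟨P', n, _, _, ⟨e₂⟩⟩ ↦ by
    have := CochainComplex.isKProjective_of_projective P m
    obtain ⟨f, hf⟩ := Q_map_surjective_of_isKProjective P P' (e₁.hom ≫ T.mor₁ ≫ e₂.inv)
    have comm : Q.map f ≫ e₂.hom = e₁.hom ≫ T.mor₁ := by simp [hf]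
    exact ⟨CochainComplex.mappingCone f, max (m - 1) n, isStrictlyLE_mappingCone f m n,
      projective_mappingCone_X f,
      ⟨Triangle.π₃.mapIso
        (isoTriangleOfIso₁₂ _ T (mappingCone_triangle_distinguished f) hT e₁ e₂ comm)⟩⟩

theorem hasProjectiveModel_singleFunctor [EnoughProjectives C] (M : C) :
    hasProjectiveModel ((singleFunctor C 0).obj M) :=
  let R := ProjectiveResolution.of M
  ⟨R.cochainComplex, 0, inferInstance, inferInstance,
    ⟨asIso (Q.map R.π') ≪≫ ((singleFunctorIsoCompQ C 0).app M).symm⟩⟩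

section Devissage

variable (P : ObjectProperty (DerivedCategory C)) [P.IsClosedUnderIsomorphisms]
  [P.IsStableUnderShift ℤ]

theorem prop_of_isGE_of_isLE_self (hP : ∀ M : C, P ((singleFunctor C 0).obj M))
    (X : DerivedCategory C) (n : ℤ) [X.IsGE n] [X.IsLE n] : P X := by
  obtain ⟨M, ⟨e⟩⟩ := exists_iso_singleFunctor_obj_of_isGE_of_isLE X n
  refine P.prop_of_iso (((singleFunctors C).shiftIso (-n) n 0 (by lia)).app M ≪≫ e.symm) ?_
  exact P.le_shift (-n) _ (hP M)

theorem prop_of_isGE_of_isLE [P.IsTriangulatedClosed₂]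
    (hP : ∀ M : C, P ((singleFunctor C 0).obj M)) (X : DerivedCategory C) (a : ℤ) (n : ℕ)
    [X.IsGE a] [X.IsLE (a + n)] : P X := by
  induction n generalizing X with
  | zero =>
    have : X.IsLE a := by simpa using ‹X.IsLE (a + (0 : ℕ))›
    exact prop_of_isGE_of_isLE_self P hP X a
  | succ n ih =>
    let b := a + (n + 1 : ℕ)
    have hLT : P ((t.truncLT b).obj X) :=
      have := t.isLE_truncLT_obj X b (a + n)
      ih _
    have hGE : P ((t.truncGE b).obj X) := prop_of_isGE_of_isLE_self P hP _ b
    exact P.ext_of_isTriangulatedClosed₂ _ (t.triangleLTGE_distinguished b X) hLT hGE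

theorem bounded_le_of_singleFunctor [P.IsTriangulatedClosed₂]
    (hP : ∀ M : C, P ((singleFunctor C 0).obj M)) : t.bounded ≤ P := by
  rintro X ⟨⟨a, ha⟩, ⟨b, hb⟩⟩
  have : X.IsGE a := ha
  have : X.IsLE (a + (b - a).toNat) := t.isLE_of_le _ b _ (by lia)
  exact prop_of_isGE_of_isLE P hP X a (b - a).toNat

end Devissage

theorem exists_iso_Q_obj_map_surjective [EnoughProjectives C] (X : DerivedCategory C)
    (hX : t.bounded X) :
    ∃ (K : CochainComplex C ℤ) (a b : ℤ), K.IsStrictlyGE a ∧ K.IsStrictlyLE b ∧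
      Nonempty (X ≅ Q.obj K) ∧ Function.Surjective (Q.map : (K ⟶ K) → (Q.obj K ⟶ Q.obj K)) := by
  have : (hasProjectiveModel (C := C)).IsTriangulatedClosed₂ := .of_isTriangulatedClosed₃
  obtain ⟨P, n, _, _, ⟨e⟩⟩ :=
    bounded_le_of_singleFunctor hasProjectiveModel hasProjectiveModel_singleFunctor X hX
  obtain ⟨⟨a, ha⟩, -⟩ := hX
  have := CochainComplex.isKProjective_of_projective P n
  have : P.IsGE a := (isGE_Q_obj_iff P a).1 (t.isGE_of_iso e.symm a)
  exact ⟨P.truncGE a, a, n, inferInstance, inferInstance, ⟨e.symm ≪≫ asIso (Q.map (P.πTruncGE a))⟩,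
    Q_map_truncGE_surjective P a (Q_map_surjective_of_isKProjective P P)⟩

end Derived

section FGModuleCat

theorem projective_fgModuleCat_of {A : Type u} [Ring A] (P : Type u)
    [AddCommGroup P] [Module A P] [Module.Finite A P] [Module.Projective A P] :
    Projective (FGModuleCat.of A P) where
  factors g q _ := by
    have hq : Function.Surjective q.hom.hom := (ModuleCat.epi_iff_surjective _).1
      (inferInstanceAs (Epi ((forget₂ (FGModuleCat A) (ModuleCat A)).map q)))
    obtain ⟨s, hs⟩ := Module.projective_lifting_property q.hom.hom g.hom.hom hq
    exact ⟨ObjectProperty.homMk (ModuleCat.ofHom s), FGModuleCat.hom_ext hs⟩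

instance enoughProjectives_fgModuleCat (A : Type u) [Ring A] :
    EnoughProjectives (FGModuleCat.{u} A) where
  presentation M := by
    obtain ⟨n, f, hf⟩ := Module.Finite.exists_fin' A M
    let p : FGModuleCat.of A (Fin n → A) ⟶ M := ObjectProperty.homMk (ModuleCat.ofHom f)
    have hp : Epi p := (ModuleCat.isFG A).ι.epi_of_epi_map ((ModuleCat.epi_iff_surjective _).2 hf)
    exact ⟨{ p := _, projective := projective_fgModuleCat_of _, f := p, epi := hp }⟩

theorem isFiniteLength_hom_fgModuleCat (k : Type v) [Field k] (A : Type u) [Ring A]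
    [Algebra k A] [FiniteDimensional k A] (M N : FGModuleCat.{u} A) :
    IsFiniteLength k (M ⟶ N) := by
  let _ : Module k M := Module.compHom M (algebraMap k A)
  let _ : Module k N := Module.compHom N (algebraMap k A)
  have : IsScalarTower k A M := .of_algebraMap_smul fun _ _ ↦ rfl
  have : IsScalarTower k A N := .of_algebraMap_smul fun _ _ ↦ rfl
  have : FiniteDimensional k M := (finite_iff_finiteDimensional k A M).1 inferInstance
  have : FiniteDimensional k N := (finite_iff_finiteDimensional k A N).1 inferInstance
  let φ : (M ⟶ N) →ₗ[k] (M →ₗ[k] N) :=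
    { toFun := fun f ↦ f.hom.hom.restrictScalars k
      map_add' := fun _ _ ↦ rfl
      map_smul' := fun _ _ ↦ rfl }
  have hφ : Function.Injective φ := fun f g hfg ↦ by
    ext x
    exact LinearMap.congr_fun hfg x
  have : FiniteDimensional k (M ⟶ N) := .of_injective φ hφ
  exact isFiniteLength_iff_isNoetherian_isArtinian.2 ⟨inferInstance, inferInstance⟩

end FGModuleCat

theorem theoremB2_general (k : Type*) [CommRing k] (C : Type u) [Category.{v} C] [Abelian C]
    [Linear k C] [EnoughProjectives C] [HasDerivedCategory.{w} C]
    (hC : ∀ X Y : C, IsFiniteLength k (X ⟶ Y)) : IsKrullSchmidt (DerivedCategory.Bounded C) where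
  exists_decomposition X := by
    obtain ⟨K, a, b, _, _, ⟨e⟩, hK⟩ := exists_iso_Q_obj_map_surjective X.obj X.property
    have hEnd : IsFiniteLength k (K ⟶ K) :=
      isFiniteLength_hom_of_isStrictlyGE_of_isStrictlyLE k K K a b fun i ↦ hC _ _
    have := hasBinaryBiproducts_of_finite_biproducts (DerivedCategory C)
    have := hasBinaryBiproducts_of_finite_biproducts (DerivedCategory.Bounded C)
    have hX : HasLocalDecomposition X.obj :=
      ((hasLocalDecomposition_of_isFiniteLength k K hEnd).map DerivedCategory.Q hK).of_iso e
    obtain ⟨n, Y, hY, hloc⟩ := (hX.fullSubcategory _ X.property).exists_iso_biproduct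
    exact ⟨n, Y, hY, fun i ↦ ⟨have := hloc i; indecomposable_of_isLocalRing_end _, hloc i⟩⟩

theorem theoremB2 (k : Type v) [Field k] (A : Type u) [Ring A] [Algebra k A]
    [FiniteDimensional k A] :
    haveI : IsNoetherianRing A := IsNoetherianRing.of_finite k A
    ∀ [HasDerivedCategory.{w} (FGModuleCat.{u} A)],
      IsKrullSchmidt (DerivedCategory.Bounded (FGModuleCat.{u} A)) := by
  have : IsNoetherianRing A := IsNoetherianRing.of_finite k A
  exact fun [_] ↦ theoremB2_general k _ (isFiniteLength_hom_fgModuleCat k A)
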